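/- All spaces are over the real scalars. A \emph{Banach lattice} is a complete normed vector lattice $E$ whose norm satisfies $\|x\|\le\|y\|$ whenever $|x|\le|y|$; a \emph{Hilbert lattice} is a Banach lattice whose norm is induced by an inner product; and $\ell_p$ ($1\le p<\infty$) is the space of $p$-summable real sequences with its usual norm and the coordinatewise order. For $n\ge 1$, an $n$-homogeneous polynomial $P(x)=A(x,\dots,x)$ on $E$, with $A\colon E^n\to\mathbb{R}$ a symmetric $n$-linear form, is \emph{positive} if $A(x_1,\dots,x_n)\ge 0$ for all $x_1,\dots,x_n\ge 0$, and a difference of two positive $n$-homogeneous polynomials is called a \emph{regular} $n$-homogeneous polynomial. A Banach lattice $E$ is a \emph{PPS lattice} (has the positive polynomial Schur property) if every sequence $(x_j)_{j=1}^\infty$ of positive vectors of $E$ such that $P(x_j)\to 0$ for every $n\ge 1$ and every regular $n$-homogeneous polynomial $P$ on $E$ satisfies $\|x_j\|\to 0$. \textbf{Corollary.} Every Hilbert lattice is a PPS lattice, and for every $1\le p<\infty$ the Banach lattice $\ell_p$ is a PPS lattice. -/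

import Mathlib

open Filter Topology
open scoped ENNReal lp

namespace PPS

/-- A (real) Banach lattice: a complete normed vector lattice whose norm is a lattice norm,
i.e. `|x| ≤ |y|` implies `‖x‖ ≤ ‖y‖`. -/
class BanachLattice (E : Type*) [NormedAddCommGroup E] [NormedSpace ℝ E] [Lattice E] : Prop
    extends IsOrderedAddMonoid E, IsOrderedModule ℝ E, HasSolidNorm E, CompleteSpace E

section Polynomials

variable {E : Type*} [AddCommGroup E] [Module ℝ E]

/-- The multilinear form `A` is symmetric. -/
def IsSymmetricForm {n : ℕ} (A : MultilinearMap ℝ (fun _ : Fin n => E) ℝ) : Prop :=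
  ∀ (σ : Equiv.Perm (Fin n)) (x : Fin n → E), A (fun i => x (σ i)) = A x

/-- The multilinear form `A` is positive. -/
def IsPositiveForm [PartialOrder E] {n : ℕ}
    (A : MultilinearMap ℝ (fun _ : Fin n => E) ℝ) : Prop :=
  ∀ x : Fin n → E, (∀ i, 0 ≤ x i) → 0 ≤ A x

/-- `P` is a positive `n`-homogeneous polynomial: the (unique) symmetric `n`-linear form `A` with
`P x = A (x, …, x)` is positive. -/
def IsPositivePolynomial [PartialOrder E] (n : ℕ) (P : E → ℝ) : Prop :=
  ∃ A : MultilinearMap ℝ (fun _ : Fin n => E) ℝ,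
    IsSymmetricForm A ∧ IsPositiveForm A ∧ ∀ x, P x = A (fun _ => x)

/-- `P` is a regular `n`-homogeneous polynomial: a difference of two positive ones. -/
def IsRegularPolynomial [PartialOrder E] (n : ℕ) (P : E → ℝ) : Prop :=
  ∃ P₁ P₂ : E → ℝ, IsPositivePolynomial n P₁ ∧ IsPositivePolynomial n P₂ ∧
    ∀ x, P x = P₁ x - P₂ x

end Polynomials

/-- The Banach lattice `E` is a PPS lattice (has the positive polynomial Schur property): every
sequence of positive vectors on which each regular homogeneous polynomial, of any degree `n ≥ 1`,
tends to `0` is norm null. -/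
def IsPPSLattice (E : Type*) [NormedAddCommGroup E] [NormedSpace ℝ E] [Lattice E]
    [BanachLattice E] : Prop :=
  ∀ x : ℕ → E, (∀ j, 0 ≤ x j) →
    (∀ n : ℕ, 1 ≤ n → ∀ P : E → ℝ, IsRegularPolynomial n P →
      Tendsto (fun j => P (x j)) atTop (𝓝 0)) →
    Tendsto (fun j => ‖x j‖) atTop (𝓝 0)

section SequenceSpaces

variable {ι : Type*} {p : ℝ≥0∞}

/-- The coordinatewise order on `ℓ^p(ι, ℝ)`. -/
instance lpPartialOrder : PartialOrder (lp (fun _ : ι => ℝ) p) where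
  le f g := ∀ i, f i ≤ g i
  le_refl _ _ := le_rfl
  le_trans _ _ _ h h' i := (h i).trans (h' i)
  le_antisymm _ _ h h' := lp.ext (funext fun i => le_antisymm (h i) (h' i))

theorem lp_le_iff (f g : lp (fun _ : ι => ℝ) p) : f ≤ g ↔ ∀ i, f i ≤ g i := Iff.rfl

theorem memℓp_abs_add_abs (f g : lp (fun _ : ι => ℝ) p) :
    Memℓp (fun i => |f i| + |g i|) p :=
  (lp.memℓp f).norm.add (lp.memℓp g).norm

/-- `ℓ^p(ι, ℝ)` is a lattice, with coordinatewise maxima and minima. -/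
instance lpLattice : Lattice (lp (fun _ : ι => ℝ) p) where
  sup f g := ⟨fun i => max (f i) (g i), (memℓp_abs_add_abs f g).mono fun _ =>
    abs_max_le_max_abs_abs.trans (max_le_add_of_nonneg (abs_nonneg _) (abs_nonneg _))⟩
  inf f g := ⟨fun i => min (f i) (g i), (memℓp_abs_add_abs f g).mono fun _ =>
    abs_min_le_max_abs_abs.trans (max_le_add_of_nonneg (abs_nonneg _) (abs_nonneg _))⟩
  le_sup_left f g i := le_max_left (f i) (g i)
  le_sup_right f g i := le_max_right (f i) (g i)
  sup_le _ _ _ h h' i := max_le (h i) (h' i)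
  inf_le_left f g i := min_le_left (f i) (g i)
  inf_le_right f g i := min_le_right (f i) (g i)
  le_inf _ _ _ h h' i := le_min (h i) (h' i)

theorem lp_abs_apply (f : lp (fun _ : ι => ℝ) p) (i : ι) : |f| i = |f i| := rfl

/-- For `1 ≤ p`, `ℓ^p(ι, ℝ)` with its norm and the coordinatewise order is a Banach lattice. -/
instance lpBanachLattice [Fact (1 ≤ p)] : BanachLattice (lp (fun _ : ι => ℝ) p) where
  add_le_add_left f g h k i := by simpa using h i
  smul_le_smul_of_nonneg_left a ha f g h i := by
    simpa using mul_le_mul_of_nonneg_left (h i) ha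
  smul_le_smul_of_nonneg_right f hf a b h i := by
    simpa using mul_le_mul_of_nonneg_right h (hf i)
  solid f g h := by
    refine lp.norm_mono (zero_lt_one.trans_le (Fact.out : 1 ≤ p)).ne' fun i => ?_
    simpa only [Real.norm_eq_abs, lp_abs_apply] using h i
  complete := CompleteSpace.complete

end SequenceSpaces

end PPS

/-! In a Hilbert lattice positive vectors have nonnegative inner product, so `‖x‖ ^ 2` is itself a
positive 2-homogeneous polynomial and settles the matter. In `ℓ_p`, coordinates are positive linear
functionals, so the sequence is coordinatewise null. If its norms did not tend to zero, a gliding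
hump (`exists_gliding_hump`) would give disjoint blocks carrying a fixed amount of mass along a
subsequence. Positive functionals `φ k` norming these humps (`exists_norming_weights`) satisfy `∑ |φ
k y| ^ p ≤ ‖y‖ ^ p`, so for an integer `n ≥ p` the sum of the `φ k ^ n` is a positive polynomial,
and it stays bounded away from zero on the humps. -/

namespace PPS

section Hilbert

variable {H : Type*} [NormedAddCommGroup H] [InnerProductSpace ℝ H] [Lattice H] [BanachLattice H]

/-- For positive vectors `|x - y| ≤ x + y`; solidity of the norm and polarization then give the
sign. -/
theorem inner_nonneg_of_nonneg {x y : H} (hx : 0 ≤ x) (hy : 0 ≤ y) : 0 ≤ inner ℝ x y := by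
  have habs : |x - y| ≤ |x + y| := by
    rw [abs_of_nonneg (add_nonneg hx hy)]
    refine abs_le'.2 ⟨?_, ?_⟩
    · rw [sub_eq_add_neg]
      gcongr
      exact (neg_nonpos.2 hy).trans hy
    · rw [neg_sub, sub_eq_add_neg, add_comm x y]
      gcongr
      exact (neg_nonpos.2 hx).trans hx
  have hn : ‖x - y‖ ≤ ‖x + y‖ := norm_le_norm_of_abs_le_abs habs
  have h1 := norm_add_mul_self_real x y
  have h2 := norm_sub_mul_self_real x y
  have h3 := mul_self_le_mul_self (norm_nonneg _) hn
  linarith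

end Hilbert

section Polynomials

variable {E : Type*} [AddCommGroup E] [Module ℝ E]

theorem IsPositivePolynomial.isRegularPolynomial [PartialOrder E] {n : ℕ} {P : E → ℝ}
    (hP : IsPositivePolynomial n P) : IsRegularPolynomial n P :=
  ⟨P, fun _ => 0, hP, ⟨0, fun _ _ => rfl, fun _ _ => le_rfl, fun _ => rfl⟩,
    fun _ => (sub_zero _).symm⟩

/-- The `n`-linear form `x ↦ ∏ i, f (x i)`. -/
noncomputable def powerForm (n : ℕ) (f : E →ₗ[ℝ] ℝ) : MultilinearMap ℝ (fun _ : Fin n => E) ℝ :=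
  (MultilinearMap.mkPiAlgebra ℝ (Fin n) ℝ).compLinearMap fun _ => f

theorem powerForm_apply (n : ℕ) (f : E →ₗ[ℝ] ℝ) (x : Fin n → E) :
    powerForm n f x = ∏ i, f (x i) := rfl

/-- The `n`-linear form `x ↦ ∑' k, ∏ i, f k (x i)`. -/
noncomputable def tsumPowerForm (n : ℕ) (f : ℕ → E →ₗ[ℝ] ℝ)
    (hf : ∀ x : Fin n → E, Summable fun k => ∏ i, f k (x i)) :
    MultilinearMap ℝ (fun _ : Fin n => E) ℝ where
  toFun x := ∑' k, powerForm n (f k) x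
  map_update_add' x i a b := by
    simp only [MultilinearMap.map_update_add]
    exact (hf _).tsum_add (hf _)
  map_update_smul' x i c a := by
    simp only [MultilinearMap.map_update_smul]
    exact tsum_const_smul'' c

theorem tsumPowerForm_apply (n : ℕ) (f : ℕ → E →ₗ[ℝ] ℝ)
    (hf : ∀ x : Fin n → E, Summable fun k => ∏ i, f k (x i)) (x : Fin n → E) :
    tsumPowerForm n f hf x = ∑' k, ∏ i, f k (x i) := rfl

/-- A sum of `n`-th powers of positive functionals is a positive polynomial. -/
theorem isPositivePolynomial_tsum_pow [PartialOrder E] (n : ℕ) (f : ℕ → E →ₗ[ℝ] ℝ)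
    (hf : ∀ x : Fin n → E, Summable fun k => ∏ i, f k (x i))
    (hpos : ∀ k x, 0 ≤ x → 0 ≤ f k x) :
    IsPositivePolynomial n fun x => ∑' k, f k x ^ n := by
  refine ⟨tsumPowerForm n f hf, fun σ x => ?_, fun x hx => ?_, fun x => ?_⟩
  · simp only [tsumPowerForm_apply]
    exact tsum_congr fun k => Equiv.prod_comp σ fun i => f k (x i)
  · rw [tsumPowerForm_apply]
    exact tsum_nonneg fun k => Finset.prod_nonneg fun i _ => hpos k _ (hx i)
  · simp [tsumPowerForm_apply]

theorem isPositivePolynomial_linear [PartialOrder E] (f : E →ₗ[ℝ] ℝ)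
    (hpos : ∀ x, 0 ≤ x → 0 ≤ f x) :
    IsPositivePolynomial 1 f := by
  refine ⟨powerForm 1 f, fun σ x => ?_, fun x hx => ?_, fun x => ?_⟩
  · exact Equiv.prod_comp σ fun i => f (x i)
  · rw [powerForm_apply]
    exact Finset.prod_nonneg fun i _ => hpos _ (hx i)
  · simp [powerForm_apply]

end Polynomials

/-- The inner product as a bilinear form in the sense of multilinear maps. -/
noncomputable def innerForm (H : Type*) [NormedAddCommGroup H] [InnerProductSpace ℝ H] :
    MultilinearMap ℝ (fun _ : Fin 2 => H) ℝ :=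
  MultilinearMap.mk' (fun x : Fin 2 → H => inner ℝ (x 0) (x 1))
    (fun x i a b => by fin_cases i <;> simp [inner_add_left, inner_add_right])
    (fun x i c a => by fin_cases i <;> simp [real_inner_smul_left, real_inner_smul_right])

theorem innerForm_apply {H : Type*} [NormedAddCommGroup H] [InnerProductSpace ℝ H]
    (x : Fin 2 → H) : innerForm H x = inner ℝ (x 0) (x 1) := rfl

theorem isPPSLattice_of_innerProductSpace (H : Type*) [NormedAddCommGroup H]
    [InnerProductSpace ℝ H] [Lattice H] [BanachLattice H] : IsPPSLattice H := by
  intro x _ h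
  have hP : IsPositivePolynomial 2 fun y : H => inner ℝ y y := by
    refine ⟨innerForm H, fun σ y => ?_, fun y hy => ?_,
      fun y => rfl⟩
    · rw [innerForm_apply, innerForm_apply]
      fin_cases σ
      · rfl
      · exact real_inner_comm _ _
    · exact inner_nonneg_of_nonneg (hy 0) (hy 1)
  have h2 := (h 2 (by norm_num) _ hP.isRegularPolynomial).sqrt
  simpa [real_inner_self_eq_norm_sq] using h2

/-- A product of `n` factors is at most the `n`-th power of the largest, hence at most the sum of
all `n`-th powers. -/
theorem summable_prod_of_summable_pow {n : ℕ} (hn : n ≠ 0) {y : Fin n → ℕ → ℝ}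
    (hy : ∀ i, Summable fun k => |y i k| ^ n) : Summable fun k => ∏ i, y i k := by
  refine Summable.of_norm_bounded (summable_sum (s := Finset.univ) fun i _ => hy i) fun k => ?_
  have : Nonempty (Fin n) := ⟨⟨0, Nat.pos_of_ne_zero hn⟩⟩
  obtain ⟨j, hj⟩ := Finite.exists_max fun i => |y i k|
  calc ‖∏ i, y i k‖ = ∏ i, |y i k| := by rw [norm_prod]; rfl
    _ ≤ ∏ _i : Fin n, |y j k| := Finset.prod_le_prod (fun _ _ => abs_nonneg _) fun i _ => hj i
    _ = |y j k| ^ n := by simp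
    _ ≤ ∑ i, |y i k| ^ n :=
      Finset.single_le_sum (f := fun i => |y i k| ^ n) (fun _ _ => by positivity)
        (Finset.mem_univ j)

theorem summable_pow_of_summable_rpow {r : ℝ} (hr : 0 < r) {n : ℕ} (hn : r ≤ n) {y : ℕ → ℝ}
    (hy : Summable fun k => |y k| ^ r) : Summable fun k => |y k| ^ n := by
  have h0 : Tendsto (fun k => |y k| ^ r) atTop (𝓝 0) := hy.tendsto_atTop_zero
  refine Summable.of_norm_bounded_eventually_nat hy ?_
  filter_upwards [h0.eventually_lt_const one_pos] with k hk
  have h1 : |y k| ≤ 1 := by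
    by_contra! hc
    exact (Real.one_lt_rpow hc hr).not_gt hk
  rw [norm_pow, Real.norm_eq_abs, abs_abs, ← Real.rpow_natCast]
  rcases (abs_nonneg (y k)).eq_or_lt with h | h
  · rw [← h, Real.zero_rpow hr.ne', Real.zero_rpow (hr.trans_le hn).ne']
  · exact Real.rpow_le_rpow_of_exponent_ge h h1 hn

/-- Finitely supported norming functionals in `ℓ_r`. -/
theorem exists_norming_weights {r : ℝ} (hr : 1 ≤ r) (F : Finset ℕ) (x : ℕ → ℝ)
    (hx : ∀ i, 0 ≤ x i) :
    ∃ w : ℕ → ℝ, (∀ i, 0 ≤ w i) ∧ (∑ i ∈ F, w i * x i) ^ r = ∑ i ∈ F, x i ^ r ∧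
      ∀ y : ℕ → ℝ, |∑ i ∈ F, w i * y i| ^ r ≤ ∑ i ∈ F, |y i| ^ r := by
  have hr0 : 0 < r := one_pos.trans_le hr
  rcases hr.eq_or_lt with rfl | hr1
  · refine ⟨fun _ => 1, fun _ => zero_le_one, by simp, fun y => ?_⟩
    simpa using Finset.abs_sum_le_sum_abs y F
  -- For `r > 1` the weights are the extremizer in Hölder's inequality; `r = 1` has no finite
  -- conjugate exponent.
  have hq := Real.HolderConjugate.conjExponent hr1
  lift x to ℕ → NNReal using hx
  obtain ⟨g, hg, hgx⟩ := (NNReal.isGreatest_Lp F x hq).1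
  refine ⟨fun i => g i, fun i => (g i).2, ?_, fun y => ?_⟩
  · have := congrArg (fun t : NNReal => (t : ℝ) ^ r) hgx
    simp only [NNReal.coe_sum, NNReal.coe_mul, NNReal.coe_rpow, one_div] at this
    rw [Real.rpow_inv_rpow (by positivity) hr0.ne'] at this
    rw [← this]
    simp only [mul_comm]
  · have hy : ∑ i ∈ F, ‖y i‖₊ * g i ≤ (∑ i ∈ F, ‖y i‖₊ ^ r) ^ (1 / r) :=
      (NNReal.isGreatest_Lp F (fun i => ‖y i‖₊) hq).2 ⟨g, hg, rfl⟩
    have hy' : ∑ i ∈ F, |y i| * g i ≤ (∑ i ∈ F, |y i| ^ r) ^ (1 / r) := by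
      simpa using NNReal.coe_le_coe.2 hy
    calc |∑ i ∈ F, (g i : ℝ) * y i| ^ r ≤ ((∑ i ∈ F, |y i| ^ r) ^ (1 / r)) ^ r := by
          gcongr
          refine ((Finset.abs_sum_le_sum_abs _ _).trans_eq ?_).trans hy'
          exact Finset.sum_congr rfl fun i _ => by rw [abs_mul, NNReal.abs_eq, mul_comm]
      _ = ∑ i ∈ F, |y i| ^ r := by
          rw [one_div, Real.rpow_inv_rpow (by positivity) hr0.ne']

/-- The gliding hump: a coordinatewise null sequence of nonnegative summable sequences with sums
infinitely often at least `δ` has a subsequence with humps of size at least `δ / 2` on successive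
intervals. -/
theorem exists_gliding_hump (u : ℕ → ℕ → ℝ) (hsum : ∀ j, Summable (u j))
    (hcoord : ∀ i, Tendsto (fun j => u j i) atTop (𝓝 0)) {δ : ℝ} (hδ : 0 < δ)
    (hfreq : ∃ᶠ j in atTop, δ ≤ ∑' i, u j i) :
    ∃ J m : ℕ → ℕ, StrictMono J ∧ Monotone m ∧
      ∀ k, δ / 2 ≤ ∑ i ∈ Finset.Ico (m k) (m (k + 1)), u (J k) i := by
  -- A state is (last index used, end of last block). Coordinates before `m` carry less than `δ / 4`
  -- and those before `m'` more than `3 * δ / 4`, leaving `δ / 2` between.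
  have step : ∀ s : ℕ × ℕ, ∃ t : ℕ × ℕ, s.1 < t.1 ∧ s.2 ≤ t.2 ∧
      δ / 2 ≤ ∑ i ∈ Finset.Ico s.2 t.2, u t.1 i := by
    rintro ⟨N, m⟩
    have h0 : Tendsto (fun j => ∑ i ∈ Finset.range m, u j i) atTop (𝓝 0) := by
      simpa using tendsto_finsetSum (Finset.range m) fun i _ => hcoord i
    obtain ⟨j, hj, hj', hNj⟩ := (hfreq.and_eventually
      ((h0.eventually_lt_const (show 0 < δ / 4 by positivity)).and
        (eventually_gt_atTop N))).exists
    have h1 := (hsum j).hasSum.tendsto_sum_nat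
    obtain ⟨m', hm', hmm'⟩ := ((h1.eventually_const_lt
      (show 3 * δ / 4 < ∑' i, u j i by linarith)).and (eventually_ge_atTop m)).exists
    refine ⟨(j, m'), hNj, hmm', ?_⟩
    rw [Finset.sum_Ico_eq_sub _ hmm']
    dsimp only at *
    linarith
  choose f hf1 hf2 hf3 using step
  let s : ℕ → ℕ × ℕ := fun k => f^[k] (0, 0)
  have hs : ∀ k, s (k + 1) = f (s k) := fun k => Function.iterate_succ_apply' f k _
  refine ⟨fun k => (s (k + 1)).1, fun k => (s k).2, strictMono_nat_of_lt_succ fun k => ?_,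
    monotone_nat_of_le_succ fun k => ?_, fun k => ?_⟩
  · rw [hs (k + 1)]; exact hf1 _
  · rw [hs k]; exact hf2 _
  · simp only [hs k]; exact hf3 _

/-- Consecutive blocks concatenate, so partial sums of block sums are bounded by the full sum. -/
theorem summable_sum_Ico {m : ℕ → ℕ} (hm : Monotone m) {v : ℕ → ℝ} (hv : ∀ i, 0 ≤ v i)
    (hs : Summable v) : Summable fun k => ∑ i ∈ Finset.Ico (m k) (m (k + 1)), v i := by
  refine summable_of_sum_range_le (c := ∑' i, v i) (fun k => Finset.sum_nonneg fun i _ => hv i)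
    fun K => ?_
  have : ∑ k ∈ Finset.range K, ∑ i ∈ Finset.Ico (m k) (m (k + 1)), v i
      = ∑ i ∈ Finset.Ico (m 0) (m K), v i := by
    induction K with
    | zero => simp
    | succ K ih =>
      rw [Finset.sum_range_succ, ih,
        Finset.sum_Ico_consecutive _ (hm (Nat.zero_le K)) (hm (Nat.le_succ K))]
  rw [this]
  exact hs.sum_le_tsum _ fun i _ => hv i

section SequenceSpaces

variable {p : ℝ≥0∞}

/-- The functional `x ↦ ∑ i ∈ F, w i * x i` on `ℓ_p`. -/
noncomputable def weightedSum (p : ℝ≥0∞) (F : Finset ℕ) (w : ℕ → ℝ) :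
    lp (fun _ : ℕ => ℝ) p →ₗ[ℝ] ℝ where
  toFun x := ∑ i ∈ F, w i * x i
  map_add' x y := by simp [mul_add, Finset.sum_add_distrib]
  map_smul' c x := by simp [Finset.mul_sum, mul_left_comm]

theorem weightedSum_apply (F : Finset ℕ) (w : ℕ → ℝ) (x : lp (fun _ : ℕ => ℝ) p) :
    weightedSum p F w x = ∑ i ∈ F, w i * x i := rfl

theorem weightedSum_nonneg {F : Finset ℕ} {w : ℕ → ℝ} (hw : ∀ i, 0 ≤ w i)
    {x : lp (fun _ : ℕ => ℝ) p} (hx : 0 ≤ x) : 0 ≤ weightedSum p F w x :=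
  Finset.sum_nonneg fun i _ => mul_nonneg (hw i) (hx i)

theorem isPPSLattice_lp (p : ℝ≥0∞) [Fact (1 ≤ p)] (hp : p ≠ ∞) :
    IsPPSLattice (lp (fun _ : ℕ => ℝ) p) := by
  intro x hx h
  set r := p.toReal with hr_def
  have hr : 1 ≤ r := by
    simpa using ENNReal.toReal_mono hp (Fact.out : 1 ≤ p)
  have hr0 : 0 < r := one_pos.trans_le hr
  have hx' : ∀ j i, 0 ≤ x j i := fun j i => hx j i
  have hsummable : ∀ y : lp (fun _ : ℕ => ℝ) p, Summable fun i => |y i| ^ r :=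
    fun y => (lp.memℓp y).summable hr0
  have hsum : ∀ j, Summable fun i => x j i ^ r := fun j => by
    simpa only [abs_of_nonneg (hx' j _)] using hsummable (x j)
  have hnorm : ∀ j, ‖x j‖ ^ r = ∑' i, x j i ^ r := fun j => by
    rw [lp.norm_rpow_eq_tsum hr0]
    simp only [Real.norm_eq_abs, abs_of_nonneg (hx' j _), hr_def]
  have hcoord : ∀ i, Tendsto (fun j => x j i ^ r) atTop (𝓝 0) := fun i => by
    have hlin := h 1 le_rfl _ (isPositivePolynomial_linear (weightedSum p {i} 1)
      fun y hy => weightedSum_nonneg (fun _ => zero_le_one) hy).isRegularPolynomial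
    simp only [weightedSum_apply, Finset.sum_singleton, Pi.one_apply, one_mul] at hlin
    simpa [Real.zero_rpow hr0.ne'] using hlin.rpow_const (p := r) (Or.inr hr0.le)
  suffices hr_tendsto : Tendsto (fun j => ‖x j‖ ^ r) atTop (𝓝 0) by
    have := hr_tendsto.rpow_const (p := r⁻¹) (Or.inr (by positivity))
    simpa [Real.rpow_rpow_inv (norm_nonneg _) hr0.ne', Real.zero_rpow (inv_ne_zero hr0.ne')]
      using this
  simp only [hnorm]
  by_contra hnot
  obtain ⟨δ, hδ, hfreq⟩ : ∃ δ > 0, ∃ᶠ j in atTop, δ ≤ ∑' i, x j i ^ r := by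
    by_contra! hc
    refine hnot (tendsto_order.2 ⟨fun a ha => .of_forall fun j => ha.trans_le ?_, fun a ha => ?_⟩)
    · exact tsum_nonneg fun i => Real.rpow_nonneg (hx' j i) r
    · simpa using hc a ha
  obtain ⟨J, m, hJ, hm, hhump⟩ := exists_gliding_hump _ hsum hcoord hδ hfreq
  choose w hw hwx hwy using fun k =>
    exists_norming_weights hr (Finset.Ico (m k) (m (k + 1))) (x (J k)) (hx' (J k))
  let φ : ℕ → lp (fun _ : ℕ => ℝ) p →ₗ[ℝ] ℝ := fun k =>
    weightedSum p (Finset.Ico (m k) (m (k + 1))) (w k)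
  -- A polynomial degree must be an integer, so `r`-summability of `φ k y` is traded for
  -- `n`-summability with `n ≥ r`.
  obtain ⟨n, hn⟩ := exists_nat_ge r
  have hn0 : n ≠ 0 := by
    rintro rfl
    exact hr0.not_ge (by simpa using hn)
  have hφr : ∀ y, Summable fun k => |φ k y| ^ r := fun y =>
    (summable_sum_Ico hm (fun i => by positivity) (hsummable y)).of_nonneg_of_le
      (fun k => by positivity) fun k => hwy k y
  have hφn : ∀ y, Summable fun k => |φ k y| ^ n := fun y =>
    summable_pow_of_summable_rpow hr0 hn (hφr y)
  have hpos : ∀ k y, 0 ≤ y → 0 ≤ φ k y := fun k y hy => weightedSum_nonneg (hw k) hy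
  have hP := h n (Nat.one_le_iff_ne_zero.2 hn0) _ (isPositivePolynomial_tsum_pow n φ
    (fun y => summable_prod_of_summable_pow hn0 fun i => hφn (y i)) hpos).isRegularPolynomial
  -- All terms of the polynomial are nonnegative on positive vectors, so it dominates its `k`-th
  -- term at `x (J k)`.
  have hφJ : Tendsto (fun k => φ k (x (J k)) ^ n) atTop (𝓝 0) := by
    refine squeeze_zero (fun k => pow_nonneg (hpos k _ (hx _)) n) (fun k => ?_)
      (hP.comp hJ.tendsto_atTop)
    have hs : Summable fun l => φ l (x (J k)) ^ n := by
      simpa only [abs_of_nonneg (hpos _ _ (hx (J k)))] using hφn (x (J k))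
    exact hs.le_tsum k fun l _ => pow_nonneg (hpos l _ (hx _)) n
  have hφ0 : Tendsto (fun k => φ k (x (J k)) ^ r) atTop (𝓝 0) := by
    have := hφJ.rpow_const (p := (n : ℝ)⁻¹ * r) (Or.inr (by positivity))
    rw [Real.zero_rpow (by positivity)] at this
    refine this.congr fun k => ?_
    have hk := hpos k _ (hx (J k))
    rw [Real.rpow_mul (by positivity), Real.pow_rpow_inv_natCast hk hn0]
  -- By the choice of weights, `φ k (x (J k)) ^ r` is exactly the mass of the `k`-th hump, which is
  -- at least `δ / 2`.
  refine (half_pos hδ).not_ge (ge_of_tendsto' hφ0 fun k => ?_)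
  exact (hhump k).trans_eq (hwx k).symm

end SequenceSpaces

end PPS

theorem mainTheorem6 :
    (∀ (H : Type*) [NormedAddCommGroup H] [InnerProductSpace ℝ H] [Lattice H]
        [PPS.BanachLattice H], PPS.IsPPSLattice H) ∧
      (∀ (p : ℝ≥0∞) [Fact (1 ≤ p)], p ≠ ∞ →
        PPS.IsPPSLattice (lp (fun _ : ℕ => ℝ) p)) :=
  ⟨fun H => PPS.isPPSLattice_of_innerProductSpace H, fun p => PPS.isPPSLattice_lp p⟩
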